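/- There is an absolute constant $c>0$ such that the following holds for all integers $n\ge 0$ and $N\ge 1$. Let $g_1,\dots,g_N$ be linear polynomials over $\mathbb{Q}$ (of the form $\sum_i a_i x_i+b$, in finitely many of the variables $x_0,x_1,x_2,\dots$), each of which depends on at least $n/2$ variables (that is, has at least $n/2$ nonzero coefficients $a_i$), and suppose that the linear clause $\bigvee_{j=1}^{N}(g_j=0)$ is a tautology, i.e. holds under every 0-1 assignment to the variables. Then every tree-like $\mathrm{Res}(\mathrm{lin}_{\mathbb{Q}})$ derivation of $\bigvee_{j=1}^{N}(g_j=0)$ has size at least $2^{c\sqrt{n}}$. Here a linear clause is a finite disjunction of equations $f=0$ with $f$ a linear polynomial over $\mathbb{Q}$, duplicate disjuncts being contracted. A tree-like $\mathrm{Res}(\mathrm{lin}_{\mathbb{Q}})$ derivation is a finite tree of linear clauses whose root is the derived clause, whose leaves are boolean axioms $x_i=0\vee x_i=1$, and each of whose inner nodes follows from its children by one of the rules: resolution (from $C\vee f=0$ and $D\vee g=0$ derive $C\vee D\vee \alpha f+\beta g=0$, with $\alpha,\beta\in\mathbb{Q}$), simplification (from $C\vee a=0$ with a constant $a\in\mathbb{Q}\setminus\{0\}$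 derive $C$), weakening (from $C$ derive $C\vee f=0$). The size of a derivation is the sum of the sizes of its clauses, with multiplicity, and the size of a clause is the number of occurrences of variables in it plus the total binary size of the coefficients (including constant terms) occurring in it, where the binary size of a rational $p/q$ in lowest terms, $q\ge 1$, is one sign bit plus the number of bits of $|p|$ plus the number of bits of $q$. -/

import Mathlib

/-! Tree-like resolution over linear equations with rational coefficients. -/

noncomputable section

namespace ResLinQ

/-- A linear polynomial `∑ i, a i * x i + b` over `ℚ` in the variables `x 0, x 1, x 2, …`,
stored as the pair `(a, b)`; sums and scalar multiples are those of the product module. -/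
abbrev LinForm : Type := (ℕ →₀ ℚ) × ℚ

namespace LinForm

/-- The variable `x i` as a linear polynomial. -/
def var (i : ℕ) : LinForm := (Finsupp.single i 1, 0)

/-- The constant polynomial `b`. -/
def const (b : ℚ) : LinForm := (0, b)

/-- The variables that `f` depends on, i.e. those with a nonzero coefficient. -/
def vars (f : LinForm) : Finset ℕ := f.1.support

/-- The value of `f` at a 0-1 assignment. -/
def eval (f : LinForm) (ρ : ℕ → Bool) : ℚ :=
  (f.1.sum fun i a => a * (if ρ i then 1 else 0)) + f.2

end LinForm

/-- A linear clause `f₁ = 0 ∨ ⋯ ∨ fₖ = 0`, as the finite set of its disjuncts `fⱼ`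
(so that duplicate disjuncts are contracted). -/
abbrev LinClause : Type := Finset LinForm

/-- `C` is a tautology: it holds under every 0-1 assignment. -/
def LinClause.IsTautology (C : LinClause) : Prop :=
  ∀ ρ : ℕ → Bool, ∃ f ∈ C, LinForm.eval f ρ = 0

/-- The boolean axiom `x i = 0 ∨ x i = 1`. -/
def boolAxiom (i : ℕ) : LinClause :=
  {LinForm.var i, LinForm.var i - LinForm.const 1}

/-- Binary size of a rational `p / q` in lowest terms: a sign bit, the bits of `|p|` and the
bits of `q`. -/
def coeffSize (r : ℚ) : ℕ := 1 + Nat.size r.num.natAbs + Nat.size r.den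

/-- Number of occurrences of variables in `f` plus the total size of the coefficients of `f`
(including the constant term). -/
def LinForm.size (f : LinForm) : ℕ :=
  f.vars.card + (∑ i ∈ f.vars, coeffSize (f.1 i)) + coeffSize f.2

/-- Number of occurrences of variables in `C` plus the total size of the coefficients in `C`. -/
def LinClause.size (C : LinClause) : ℕ := ∑ f ∈ C, LinForm.size f

/-- Tree-like derivations of linear clauses from a set `φ` of linear clauses. The lines of a
derivation are the nodes of the tree; each one is used at most once as a premise. -/
inductive TreeDerivation (φ : Set LinClause) : LinClause → Type
  /-- An element of `φ`. -/
  | hyp (C : LinClause) (hC : C ∈ φ) : TreeDerivation φ C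
  /-- A boolean axiom. -/
  | bool (i : ℕ) : TreeDerivation φ (boolAxiom i)
  /-- Resolution: from `C ∨ f = 0` and `D ∨ g = 0` derive `C ∨ D ∨ α f + β g = 0`. -/
  | resolution (C D : LinClause) (f g : LinForm) (α β : ℚ)
      (π₁ : TreeDerivation φ (insert f C)) (π₂ : TreeDerivation φ (insert g D)) :
      TreeDerivation φ (insert (α • f + β • g) (C ∪ D))
  /-- Simplification: from `C ∨ a = 0` with a constant `a ≠ 0` derive `C`. -/
  | simplification (C : LinClause) (a : ℚ) (ha : a ≠ 0)
      (π : TreeDerivation φ (insert (LinForm.const a) C)) : TreeDerivation φ C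
  /-- Weakening: from `C` derive `C ∨ f = 0`. -/
  | weakening (C : LinClause) (f : LinForm)
      (π : TreeDerivation φ C) : TreeDerivation φ (insert f C)

/-- The size of a derivation: the total size of all its lines. -/
def TreeDerivation.size {φ : Set LinClause} :
    {C : LinClause} → TreeDerivation φ C → ℕ
  | _, .hyp C _ => LinClause.size C
  | _, .bool i => LinClause.size (boolAxiom i)
  | _, .resolution C D f g α β π₁ π₂ =>
      π₁.size + π₂.size + LinClause.size (insert (α • f + β • g) (C ∪ D))
  | _, .simplification C _ _ π => π.size + LinClause.size C
  | _, .weakening C f π => π.size + LinClause.size (insert f C)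

end ResLinQ

end

namespace ResLinQ

open Finset

/-! Walk from the root towards the leaves, keeping a set `A` of linear forms such that `avoiding A`
is nonempty and every disjunct of the current clause satisfies `IsNonzeroOrWide`. At a resolution
step where neither premise form `f`, `g` has this property, neither vanishes identically on
`avoiding A`; so `f` can be added to `A` for one premise and `g` for the other, and the walk
branches. An axiom cannot be reached while `A` is small, so the tree branches fully to linear depth
(`TreeDerivation.two_pow_le_size`).

What makes a wide form resist few hyperplanes is `card_vars_le_of_eval_eq_zero`, an Alon–Füredi type
covering argument. The resulting bound is in fact exponential in `n`. -/

/-- The alternating sum over a cube of a product of fewer affine functions than the dimension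
of the cube is zero. -/
theorem sum_powerset_neg_one_pow_mul_prod_eq_zero {ι κ : Type*} [DecidableEq ι] [DecidableEq κ]
    (b : κ → ℚ) (d : κ → ι → ℚ) (S : Finset ι) :
    ∀ A : Finset κ, A.card < S.card →
      ∑ T ∈ S.powerset, (-1 : ℚ) ^ T.card * ∏ a ∈ A, (b a + ∑ i ∈ T, d a i) = 0 := by
  induction S using Finset.induction_on with
  | empty => intro A hA; simp at hA
  | insert i S hi ih =>
    intro A hA
    rw [card_insert_of_notMem hi] at hA
    have key : ∀ T ∈ S.powerset,
        (-1 : ℚ) ^ (insert i T).card * ∏ a ∈ A, (b a + ∑ j ∈ insert i T, d a j) =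
          -∑ B ∈ A.powerset, (∏ a ∈ A \ B, d a i) *
            ((-1 : ℚ) ^ T.card * ∏ a ∈ B, (b a + ∑ j ∈ T, d a j)) := by
      intro T hT
      have hiT : i ∉ T := fun h => hi (mem_powerset.1 hT h)
      have e : ∀ a ∈ A, b a + ∑ j ∈ insert i T, d a j = (b a + ∑ j ∈ T, d a j) + d a i := by
        intro a _
        rw [sum_insert hiT]
        ring
      rw [prod_congr rfl e, prod_add, card_insert_of_notMem hiT, mul_sum, ← sum_neg_distrib]
      refine sum_congr rfl fun B _ => ?_
      ring
    -- Only `B = A` survives, since proper subsets fall to `ih`; its term cancels the sum over the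
    -- `T` without `i`.
    rw [sum_powerset_insert hi, sum_congr rfl key, sum_neg_distrib, sum_comm,
      sum_eq_single_of_mem A (mem_powerset_self A)]
    · simp
    · intro B hB hBA
      have hlt : B.card < A.card :=
        card_lt_card ((mem_powerset.1 hB).ssubset_of_ne hBA)
      rw [← mul_sum, ih B (by omega), mul_zero]

namespace LinForm

theorem eval_eq_sum (f : LinForm) (ρ : ℕ → Bool) {K : Finset ℕ} (hK : f.vars ⊆ K) :
    f.eval ρ = ∑ i ∈ K, f.1 i * (if ρ i then 1 else 0) + f.2 := by
  rw [eval, Finsupp.sum_of_support_subset _ hK]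
  simp

theorem eval_combination (f g : LinForm) (α β : ℚ) (ρ : ℕ → Bool) :
    (α • f + β • g).eval ρ = α * f.eval ρ + β * g.eval ρ := by
  have h : (α • f + β • g).vars ⊆ f.vars ∪ g.vars := by
    intro i hi
    simp only [vars, mem_union, Finsupp.mem_support_iff] at hi ⊢
    by_contra! hc
    simp [hc.1, hc.2] at hi
  rw [eval_eq_sum _ ρ h, eval_eq_sum f ρ subset_union_left, eval_eq_sum g ρ subset_union_right]
  simp only [Prod.fst_add, Prod.smul_fst, Prod.snd_add, Prod.smul_snd, Finsupp.add_apply,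
    Finsupp.smul_apply, smul_eq_mul, mul_add, mul_sum, add_mul, sum_add_distrib, mul_assoc]
  ring

theorem eval_const (a : ℚ) (ρ : ℕ → Bool) : (const a).eval ρ = a := by
  simp [const, eval]

theorem eval_var (i : ℕ) (ρ : ℕ → Bool) : (var i).eval ρ = if ρ i then 1 else 0 := by
  simp [var, eval]

theorem eval_var_sub_one (i : ℕ) (ρ : ℕ → Bool) :
    (var i - const 1).eval ρ = (if ρ i then 1 else 0) - 1 := by
  have h := eval_combination (var i) (const 1) 1 (-1) ρ
  rw [eval_var, eval_const] at h
  rw [show var i - const 1 = (1 : ℚ) • var i + (-1 : ℚ) • const 1 by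
    rw [one_smul, neg_smul, one_smul, sub_eq_add_neg], h]
  ring

end LinForm

/-- The assignment `v` with the values on `T` negated. -/
def flipOn (v : ℕ → Bool) (T : Finset ℕ) : ℕ → Bool := fun i => if i ∈ T then !(v i) else v i

theorem LinForm.eval_flipOn (f : LinForm) (v : ℕ → Bool) (T : Finset ℕ) :
    f.eval (flipOn v T) = f.eval v + ∑ i ∈ T, f.1 i * (if v i then -1 else 1) := by
  have hT : ∑ i ∈ T, f.1 i * (if v i then (-1 : ℚ) else 1) =
      ∑ i ∈ f.vars ∪ T, if i ∈ T then f.1 i * (if v i then (-1 : ℚ) else 1) else 0 := by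
    rw [← sum_filter]
    congr 1
    ext i
    simp
  rw [f.eval_eq_sum (flipOn v T) (subset_union_left (s₂ := T)),
    f.eval_eq_sum v (subset_union_left (s₂ := T)), hT, add_right_comm, ← sum_add_distrib]
  congr 1
  refine sum_congr rfl fun i _ => ?_
  by_cases hi : i ∈ T <;> cases hv : v i <;> simp [flipOn, hi, hv]

/-! ### Covering cubes by hyperplanes -/

/-- The 0-1 assignments that lie on none of the hyperplanes `a = 0` with `a ∈ A`. -/
def avoiding (A : Finset LinForm) : Set (ℕ → Bool) := {ρ | ∀ a ∈ A, a.eval ρ ≠ 0}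

theorem avoiding_insert_subset (A : Finset LinForm) (f : LinForm) :
    avoiding (insert f A) ⊆ avoiding A :=
  fun _ hρ a ha => hρ a (mem_insert_of_mem ha)

/-- Hyperplanes that cover a cube of dimension `|S|` except for exactly one vertex are at least
`|S|` in number. -/
theorem card_le_card_of_cover_flipOn (A : Finset LinForm) (S : Finset ℕ) (v : ℕ → Bool)
    (hv : v ∈ avoiding A) (h : ∀ T ⊆ S, T.Nonempty → flipOn v T ∉ avoiding A) :
    S.card ≤ A.card := by
  by_contra! hlt
  have h0 := sum_powerset_neg_one_pow_mul_prod_eq_zero (fun a : LinForm => a.eval v)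
    (fun a i => a.1 i * (if v i then -1 else 1)) S A hlt
  rw [sum_eq_single_of_mem ∅ (empty_mem_powerset S)] at h0
  · simp only [card_empty, pow_zero, one_mul, sum_empty, add_zero] at h0
    obtain ⟨a, ha, h1⟩ := prod_eq_zero_iff.1 h0
    exact hv a ha h1
  · intro T hT hne
    have h1 := h T (mem_powerset.1 hT) (nonempty_iff_ne_empty.2 hne)
    simp only [avoiding, Set.mem_ofPred_eq, not_forall, not_not] at h1
    obtain ⟨a, ha, h1⟩ := h1
    rw [a.eval_flipOn] at h1
    rw [prod_eq_zero ha h1, mul_zero]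

/-- A linear form that vanishes at all points avoiding `A` has at most `2 |A|` variables. -/
theorem card_vars_le_of_eval_eq_zero (A : Finset LinForm) (h : LinForm)
    (hne : (avoiding A).Nonempty) (hz : ∀ ρ ∈ avoiding A, h.eval ρ = 0) :
    h.vars.card ≤ 2 * A.card := by
  obtain ⟨v, hv⟩ := hne
  set ε : ℕ → ℚ := fun i => h.1 i * (if v i then -1 else 1) with hε
  have hε0 : ∀ i ∈ h.vars, ε i ≠ 0 := by
    intro i hi
    have : h.1 i ≠ 0 := Finsupp.mem_support_iff.1 hi
    simp only [hε]
    split_ifs <;> simpa using this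
  have key : ∀ S : Finset ℕ, (∀ T ⊆ S, T.Nonempty → ∑ i ∈ T, ε i ≠ 0) → S.card ≤ A.card := by
    intro S hS
    refine card_le_card_of_cover_flipOn A S v hv fun T hT hTn hmem => hS T hT hTn ?_
    have h1 := hz _ hmem
    rwa [h.eval_flipOn, hz v hv, zero_add] at h1
  -- Flipping a nonempty set of variables with `ε` of one sign moves `h` strictly away from 0, hence
  -- out of `avoiding A`.
  have hpos := key (h.vars.filter fun i => 0 < ε i) fun T hT hTn =>
    (sum_pos (fun i hi => (mem_filter.1 (hT hi)).2) hTn).ne'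
  have hneg := key (h.vars.filter fun i => ¬ 0 < ε i) fun T hT hTn =>
    (sum_neg (fun i hi => by
      have h1 := mem_filter.1 (hT hi)
      exact lt_of_le_of_ne (not_lt.1 h1.2) (hε0 i h1.1)) hTn).ne
  have := card_filter_add_card_filter_not (s := h.vars) (fun i => 0 < ε i)
  omega

/-! ### The invariant on disjuncts -/

/-- On `avoiding A`, the form `f` has no zero or is a nonzero multiple of a form with at least
`w` variables. -/
def IsNonzeroOrWide (w : ℕ) (A : Finset LinForm) (f : LinForm) : Prop :=
  (∀ ρ ∈ avoiding A, f.eval ρ ≠ 0) ∨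
    ∃ h : LinForm, w ≤ h.vars.card ∧ ∃ c : ℚ, c ≠ 0 ∧ ∀ ρ ∈ avoiding A, f.eval ρ = c * h.eval ρ

theorem IsNonzeroOrWide.insert {w : ℕ} {A : Finset LinForm} {f : LinForm}
    (hf : IsNonzeroOrWide w A f) (g : LinForm) : IsNonzeroOrWide w (insert g A) f := by
  rcases hf with hf | ⟨h, hw, c, hc, hf⟩
  · exact .inl fun ρ hρ => hf ρ (avoiding_insert_subset A g hρ)
  · exact .inr ⟨h, hw, c, hc, fun ρ hρ => hf ρ (avoiding_insert_subset A g hρ)⟩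

theorem IsNonzeroOrWide.not_eval_eq_zero {w : ℕ} {A : Finset LinForm} {f : LinForm}
    (hf : IsNonzeroOrWide w A f) (hne : (avoiding A).Nonempty) (hA : 2 * A.card < w) :
    ¬ ∀ ρ ∈ avoiding A, f.eval ρ = 0 := by
  intro hz
  rcases hf with hf | ⟨h, hw, c, hc, hf⟩
  · obtain ⟨ρ, hρ⟩ := hne
    exact hf ρ hρ (hz ρ hρ)
  · have := card_vars_le_of_eval_eq_zero A h hne fun ρ hρ => by
      have h1 := hf ρ hρ
      rw [hz ρ hρ] at h1
      exact (mul_eq_zero.1 h1.symm).resolve_left hc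
    omega

/-- Handles a resolvent one of whose premise forms vanishes on `avoiding A`. The factor `β` is
nonzero because `f` cannot vanish identically there, so it can be divided out. -/
theorem IsNonzeroOrWide.of_eval_eq_mul {w : ℕ} {A : Finset LinForm} {f g : LinForm}
    (hf : IsNonzeroOrWide w A f) (hne : (avoiding A).Nonempty) (hA : 2 * A.card < w) {β : ℚ}
    (h : ∀ ρ ∈ avoiding A, f.eval ρ = β * g.eval ρ) : IsNonzeroOrWide w A g := by
  have hβ : β ≠ 0 := by
    rintro rfl
    exact hf.not_eval_eq_zero hne hA fun ρ hρ => by rw [h ρ hρ, zero_mul]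
  rcases hf with hf | ⟨k, hw, c, hc, hf⟩
  · exact .inl fun ρ hρ h0 => hf ρ hρ (by rw [h ρ hρ, h0, mul_zero])
  · refine .inr ⟨k, hw, β⁻¹ * c, mul_ne_zero (inv_ne_zero hβ) hc, fun ρ hρ => ?_⟩
    rw [mul_assoc, ← hf ρ hρ, h ρ hρ, inv_mul_cancel_left₀ hβ]

/-- If `f` depends on at most one variable, it can only be nonzero or wide by having no zero. -/
theorem IsNonzeroOrWide.eval_ne_zero {w : ℕ} {A : Finset LinForm} {f : LinForm}
    (hf : IsNonzeroOrWide w A f) (hne : (avoiding A).Nonempty) (hA : 2 * A.card + 1 < w)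
    (h1 : f.vars.card ≤ 1) : ∀ ρ ∈ avoiding A, f.eval ρ ≠ 0 := by
  rcases hf with hf | ⟨h, hw, c, hc, hf⟩
  · exact hf
  · exfalso
    -- `f - c h` vanishes on `avoiding A`, so it has few variables, and `h` has at most one more.
    have hz := card_vars_le_of_eval_eq_zero A ((1 : ℚ) • f + (-c) • h) hne fun ρ hρ => by
      rw [LinForm.eval_combination, hf ρ hρ]
      ring
    have hsub : h.vars ⊆ f.vars ∪ ((1 : ℚ) • f + (-c) • h).vars := by
      intro i hi
      simp only [LinForm.vars, mem_union, Finsupp.mem_support_iff] at hi ⊢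
      by_contra! hc'
      have h2 := hc'.2
      simp [hc'.1, hc, hi] at h2
    have := (card_le_card hsub).trans (card_union_le _ _)
    omega

theorem exists_eval_boolAxiom_eq_zero (i : ℕ) (ρ : ℕ → Bool) :
    ∃ f ∈ boolAxiom i, f.vars.card ≤ 1 ∧ f.eval ρ = 0 := by
  by_cases h : ρ i
  · refine ⟨LinForm.var i - LinForm.const 1, by simp [boolAxiom], ?_, ?_⟩
    · refine (card_le_card (Finsupp.support_single_subset (a := i) (b := (1 : ℚ)))).trans' ?_
      simp [LinForm.vars, LinForm.var, LinForm.const]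
    · simp [LinForm.eval_var_sub_one, h]
  · refine ⟨LinForm.var i, by simp [boolAxiom], ?_, ?_⟩
    · exact card_le_card (Finsupp.support_single_subset (a := i) (b := (1 : ℚ)))
    · simp [LinForm.eval_var, h]

theorem two_le_size_boolAxiom (i : ℕ) : 2 ≤ (boolAxiom i).size := by
  have h1 : ∀ f : LinForm, 1 ≤ f.size := fun f => by
    unfold LinForm.size coeffSize
    omega
  have hne : LinForm.var i ≠ LinForm.var i - LinForm.const 1 := by
    intro h
    simpa [LinForm.var, LinForm.const] using congrArg Prod.snd h
  rw [LinClause.size, boolAxiom, sum_pair hne]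
  have := h1 (LinForm.var i)
  have := h1 (LinForm.var i - LinForm.const 1)
  omega

/-! ### Lower bound on size -/

theorem TreeDerivation.two_le_size {C : LinClause} (π : TreeDerivation ∅ C) : 2 ≤ π.size := by
  induction π with
  | hyp C hC => exact hC.elim
  | bool i => exact two_le_size_boolAxiom i
  | resolution C D f g α β π₁ π₂ ih₁ ih₂ => rw [size]; omega
  | simplification C a ha π ih => rw [size]; omega
  | weakening C f π ih => rw [size]; omega

/-- The size of a derivation is exponential in the number of hyperplanes that have to be added
to `A` to reach half of the number of variables in the wide disjuncts. -/
theorem TreeDerivation.two_pow_le_size (m : ℕ) {C : LinClause} (π : TreeDerivation ∅ C) :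
    ∀ A : Finset LinForm, (avoiding A).Nonempty → (∀ f ∈ C, IsNonzeroOrWide (2 * m) A f) →
      2 ^ (m - A.card + 1) ≤ π.size := by
  induction π with
  | hyp C hC => exact hC.elim
  | bool i =>
    intro A hne hC
    rcases lt_or_ge A.card m with hA | hA
    · obtain ⟨ρ, hρ⟩ := id hne
      obtain ⟨f, hf, h1, h0⟩ := exists_eval_boolAxiom_eq_zero i ρ
      exact absurd h0 ((hC f hf).eval_ne_zero hne (by omega) h1 ρ hρ)
    -- The subtraction is truncated: once `A` has `m` elements, only size at least 2 is claimed.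
    · rw [Nat.sub_eq_zero_of_le hA]
      exact two_le_size_boolAxiom i
  | resolution C D f g α β π₁ π₂ ih₁ ih₂ =>
    intro A hne hC
    rcases lt_or_ge A.card m with hA | hA
    swap
    · rw [Nat.sub_eq_zero_of_le hA]
      exact two_le_size (.resolution C D f g α β π₁ π₂)
    rw [size]
    have hh := hC _ (mem_insert_self _ _)
    have h₁ : ∀ B, (∀ k, IsNonzeroOrWide (2 * m) A k → IsNonzeroOrWide (2 * m) B k) →
        IsNonzeroOrWide (2 * m) B f → ∀ k ∈ insert f C, IsNonzeroOrWide (2 * m) B k := by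
      intro B hB hf k hk
      rcases mem_insert.1 hk with rfl | hk
      · exact hf
      · exact hB k (hC k (mem_insert_of_mem (mem_union_left _ hk)))
    have h₂ : ∀ B, (∀ k, IsNonzeroOrWide (2 * m) A k → IsNonzeroOrWide (2 * m) B k) →
        IsNonzeroOrWide (2 * m) B g → ∀ k ∈ insert g D, IsNonzeroOrWide (2 * m) B k := by
      intro B hB hg k hk
      rcases mem_insert.1 hk with rfl | hk
      · exact hg
      · exact hB k (hC k (mem_insert_of_mem (mem_union_right _ hk)))
    by_cases hf : IsNonzeroOrWide (2 * m) A f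
    · have := ih₁ A hne (h₁ A (fun _ => id) hf)
      omega
    by_cases hg : IsNonzeroOrWide (2 * m) A g
    · have := ih₂ A hne (h₂ A (fun _ => id) hg)
      omega
    have hf0 : ∃ ρ ∈ avoiding A, f.eval ρ ≠ 0 := by
      by_contra! hz
      exact hg (hh.of_eval_eq_mul hne (by omega) (β := β) fun ρ hρ => by
        rw [LinForm.eval_combination, hz ρ hρ, mul_zero, zero_add])
    have hg0 : ∃ ρ ∈ avoiding A, g.eval ρ ≠ 0 := by
      by_contra! hz
      exact hf (hh.of_eval_eq_mul hne (by omega) (β := α) fun ρ hρ => by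
        rw [LinForm.eval_combination, hz ρ hρ, mul_zero, add_zero])
    -- Adding one form lowers the exponent by at most one, so the bounds for the two premises add up
    -- to the required power.
    have step : ∀ k : LinForm, (∃ ρ ∈ avoiding A, k.eval ρ ≠ 0) →
        (avoiding (insert k A)).Nonempty ∧ IsNonzeroOrWide (2 * m) (insert k A) k ∧
          2 ^ (m - A.card) ≤ 2 ^ (m - (insert k A).card + 1) := by
      rintro k ⟨ρ, hρ, hk⟩
      refine ⟨⟨ρ, ?_⟩, .inl fun ρ hρ => hρ k (mem_insert_self _ _), ?_⟩
      · intro a ha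
        rcases mem_insert.1 ha with rfl | ha
        · exact hk
        · exact hρ a ha
      · have := card_insert_le k A
        exact Nat.pow_le_pow_right (by norm_num) (by omega)
    obtain ⟨hfn, hfw, hfp⟩ := step f hf0
    obtain ⟨hgn, hgw, hgp⟩ := step g hg0
    have e₁ := ih₁ _ hfn (h₁ _ (fun k hk => hk.insert f) hfw)
    have e₂ := ih₂ _ hgn (h₂ _ (fun k hk => hk.insert g) hgw)
    rw [pow_succ]
    omega
  | simplification C a ha π ih =>
    intro A hne hC
    rw [size]
    have := ih A hne fun k hk => by
      rcases mem_insert.1 hk with rfl | hk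
      · exact .inl fun ρ _ => by rwa [LinForm.eval_const]
      · exact hC k hk
    omega
  | weakening C f π ih =>
    intro A hne hC
    rw [size]
    have := ih A hne fun k hk => hC k (mem_insert_of_mem hk)
    omega

end ResLinQ

theorem mainTheorem3 :
    ∃ c : ℝ, 0 < c ∧
      ∀ (n N : ℕ), 0 < N →
        ∀ g : Fin N → ResLinQ.LinForm,
          (∀ j, (n : ℝ) / 2 ≤ ((ResLinQ.LinForm.vars (g j)).card : ℝ)) →
          ResLinQ.LinClause.IsTautology (Finset.univ.image g) →
          ∀ π : ResLinQ.TreeDerivation ∅ (Finset.univ.image g),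
            (2 : ℝ) ^ (c * Real.sqrt (n : ℝ)) ≤ (π.size : ℝ) := by
  -- Width `n / 2` allows `m = n / 4`; the `+ 1` in the exponent absorbs the rounding.
  refine ⟨1 / 4, by norm_num, fun n N _ g hg _ π => ?_⟩
  have hπ := π.two_pow_le_size (n / 4) ∅ ⟨fun _ => false, by simp [ResLinQ.avoiding]⟩ (by
    intro f hf
    obtain ⟨j, -, rfl⟩ := Finset.mem_image.1 hf
    refine .inr ⟨g j, ?_, 1, one_ne_zero, fun ρ _ => (one_mul _).symm⟩
    have h1 : (n : ℝ) ≤ ((2 * (g j).vars.card : ℕ) : ℝ) := by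
      push_cast
      linarith [hg j]
    have h2 := Nat.cast_le.1 h1
    omega)
  rw [Finset.card_empty, Nat.sub_zero] at hπ
  have hn : (n : ℝ) ≤ 4 * ((n / 4 + 1 : ℕ) : ℝ) := by
    exact_mod_cast (by omega : n ≤ 4 * (n / 4 + 1))
  have hs : Real.sqrt n ≤ n := by
    rw [Real.sqrt_le_left (by positivity)]
    exact_mod_cast Nat.le_self_pow two_ne_zero n
  calc (2 : ℝ) ^ (1 / 4 * Real.sqrt (n : ℝ)) ≤ (2 : ℝ) ^ ((n / 4 + 1 : ℕ) : ℝ) :=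
        Real.rpow_le_rpow_of_exponent_le (by norm_num) (by linarith)
    _ = ((2 ^ (n / 4 + 1) : ℕ) : ℝ) := by rw [Real.rpow_natCast]; push_cast; rfl
    _ ≤ π.size := by exact_mod_cast hπ
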